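/- **Setting.** Fix an integer $k \ge 1$ and a real number $\epsilon$. Qubits are located at points of the grid $\mathbb{Z}^k$; for a finite $A \subset \mathbb{Z}^k$ let $\mathcal{H}_A = (\mathbb{C}^2)^{\otimes A}$. Write $\|X\|_1 = \tfrac12 \operatorname{tr}|X|$ for an operator $X$, and $\|\Phi\|_1 = \sup_\rho \|\Phi(\rho)\|_1$ over density matrices $\rho$ for a linear map $\Phi$ on operators. Write $\operatorname{tr}_{\neg y}$ for the partial trace over all qubits except $y$. For each $n \in \mathbb{N}$ let $Q_n \subset \mathbb{Z}^k$ be a finite set, the (arbitrary) locations of the data qubits of the instance of size $n$ (for example $|Q_n| = n$), and let $\mathcal{E}_n$ be a CPTP map on the operators on $\mathcal{H}_{Q_n}$. **Sensitivity.** For $x, y \in Q_n$ say that $x$ *affects* $y$ if there is a CPTP map $\mathcal{F}$ acting only on the qubit $x$ such that $\|\operatorname{tr}_{\neg y}(\mathcal{E}_n \mathcal{F} - \mathcal{E}_n)\|_1 \ge \epsilon$. The family $(\mathcal{E}_n)$ is *$\epsilon$-sensitive* if there is a constant $c_0 > 0$ such that for all sufficiently large $n$ at least one of the following holds: there is $y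 \in Q_n$ that is affected by at least $c_0 n$ qubits $x \in Q_n$ ($\epsilon$-input sensitive), or there is $x \in Q_n$ that affects at least $c_0 n$ qubits $y \in Q_n$ ($\epsilon$-output sensitive). **Circuits.** A $k$-D NANTC circuit on data qubits $Q_n$ consists of a finite region $R \subset \mathbb{Z}^k$ with $Q_n \subseteq R$ and a sequence $S_1, \dots, S_d$ of finite sets of operations. The operations in each $S_i$ act on pairwise disjoint sets of qubits in $R$, and each is a CPTP map on a single qubit or on two neighbouring qubits (qubits at $\ell_1$ distance $1$). No operation depends on measurement outcomes. The *depth* of the circuit is $d$. The circuit implements the map on operators on $\mathcal{H}_{Q_n}$ obtained by initialising all ancillas (the qubits in $R \setminus Q_n$) to $|0\rangle$, applying $S_1, \dots, S_d$ in order, and tracing out the ancillas; this map is also denoted by the name of the circuit. **Theorem.** Let $(\mathcal{E}_n)$ be an $\epsilon$-sensitive family of CPTP maps as above. Then any family of $k$-D NANTC circuits $C_n$ on the data qubits $Q_n$ such that $\|\mathcal{E}_n - C_n\|_1 < \epsilon/2$ for all $n$ has depth $\Omega(\sqrt[k]{n})$: there is a constant $c > 0$ such that $C_n$ has depth at least $c\,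 n^{1/k}$ for all sufficiently large $n$. -/

import Mathlib

open Filter

noncomputable section

namespace NANTC

/-! ### Operators and quantum operations -/

/-- Operators on the Hilbert space `(ℂ²)^{⊗ A}` of the qubits in the finite set `A`; the
computational basis is indexed by the bit strings `A → Fin 2`. -/
abbrev QOp {V : Type*} (A : Finset V) : Type _ :=
  Matrix (↥A → Fin 2) (↥A → Fin 2) ℂ

section General

open scoped ComplexOrder

variable {m n : Type*} [Fintype m] [Fintype n]

/-- Density matrices: positive semidefinite matrices of trace one. -/
def IsDensity (ρ : Matrix m m ℂ) : Prop :=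
  ρ.PosSemidef ∧ ρ.trace = 1

/-- The map `Φ ⊗ id` on `Mat_m ⊗ Mat_d`, for a linear map `Φ : Mat_m → Mat_n`. -/
def ampliation (Φ : Matrix m m ℂ →ₗ[ℂ] Matrix n n ℂ) (d : ℕ)
    (M : Matrix (m × Fin d) (m × Fin d) ℂ) : Matrix (n × Fin d) (n × Fin d) ℂ :=
  Matrix.of fun p q => Φ (Matrix.of fun i j => M (i, p.2) (j, q.2)) p.1 q.1

/-- Completely positive and trace preserving (CPTP) linear maps. -/
structure IsCPTP (Φ : Matrix m m ℂ →ₗ[ℂ] Matrix n n ℂ) : Prop where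
  completelyPositive : ∀ (d : ℕ) (M : Matrix (m × Fin d) (m × Fin d) ℂ),
    M.PosSemidef → (ampliation Φ d M).PosSemidef
  tracePreserving : ∀ M : Matrix m m ℂ, (Φ M).trace = M.trace

open scoped MatrixOrder in
/-- The trace norm with the normalisation `‖A‖₁ = (1/2) tr |A|`, where `|A| = √(Aᴴ A)`. -/
def traceNorm [DecidableEq m] (A : Matrix m m ℂ) : ℝ :=
  (1 / 2) * (CFC.abs A).trace.re

/-- The operator version of the trace norm, `‖Φ‖₁ = sup_ρ ‖Φ ρ‖₁` over density matrices `ρ`. -/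
def opTraceNorm [DecidableEq n] (Φ : Matrix m m ℂ →ₗ[ℂ] Matrix n n ℂ) : ℝ :=
  ⨆ ρ : {ρ : Matrix m m ℂ // IsDensity ρ}, traceNorm (Φ ρ.1)

end General

/-! ### Subsystems -/

section Subsystems

variable {V : Type*} [DecidableEq V] {A R : Finset V}

/-- The bit string on `R` that is `a` on `A` and `b` on `R \ A`. -/
def merge (a : ↥A → Fin 2) (b : ↥(R \ A) → Fin 2) : ↥R → Fin 2 := fun v =>
  if h : v.1 ∈ A then a ⟨v.1, h⟩ else b ⟨v.1, Finset.mem_sdiff.2 ⟨v.2, h⟩⟩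

/-- The restriction of a bit string on `R` to a subset. -/
def bits (h : A ⊆ R) (f : ↥R → Fin 2) : ↥A → Fin 2 := fun v => f ⟨v.1, h v.2⟩

/-- The partial trace over all qubits of `R` except those in `A`. -/
def partialTrace (A R : Finset V) : QOp R →ₗ[ℂ] QOp A where
  toFun M := Matrix.of fun a b => ∑ c : ↥(R \ A) → Fin 2, M (merge a c) (merge b c)
  map_add' M N := by
    ext a b
    simp [Finset.sum_add_distrib]
  map_smul' z M := by
    ext a b
    simp [Finset.mul_sum]

/-- The operation `Φ ⊗ id` on the qubits of `R` that applies `Φ` to the qubits in `A` and does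
nothing to those in `R \ A`. -/
def actOn (h : A ⊆ R) (Φ : QOp A →ₗ[ℂ] QOp A) : QOp R →ₗ[ℂ] QOp R where
  toFun M := Matrix.of fun f g =>
    Φ (Matrix.of fun a b =>
        M (merge a (bits Finset.sdiff_subset f)) (merge b (bits Finset.sdiff_subset g)))
      (bits h f) (bits h g)
  map_add' M N := by
    ext f g
    exact congrFun (congrFun (map_add Φ
      (Matrix.of fun a b =>
        M (merge a (bits Finset.sdiff_subset f)) (merge b (bits Finset.sdiff_subset g)))
      (Matrix.of fun a b =>
        N (merge a (bits Finset.sdiff_subset f)) (merge b (bits Finset.sdiff_subset g)))) _) _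
  map_smul' z M := by
    ext f g
    exact congrFun (congrFun (map_smul Φ z
      (Matrix.of fun a b =>
        M (merge a (bits Finset.sdiff_subset f)) (merge b (bits Finset.sdiff_subset g)))) _) _

/-- Adjoin the ancilla qubits of `R \ A`, each in the state `|0⟩`: this is
`ρ ↦ ρ ⊗ |0…0⟩⟨0…0|`. -/
def addAncillas (h : A ⊆ R) : QOp A →ₗ[ℂ] QOp R where
  toFun ρ := Matrix.of fun f g =>
    if bits (A := R \ A) Finset.sdiff_subset f = 0 ∧ bits (A := R \ A) Finset.sdiff_subset g = 0
    then ρ (bits h f) (bits h g) else 0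
  map_add' M N := by
    ext f g
    simp only [Matrix.of_apply, Matrix.add_apply]
    split_ifs <;> simp
  map_smul' z M := by
    ext f g
    simp only [Matrix.of_apply, Matrix.smul_apply, RingHom.id_apply]
    split_ifs <;> simp

/-- `F` is a CPTP map on the qubits of `R` that acts only on the qubit `x`. -/
def IsCPTPOnlyOn (x : ↥R) (F : QOp R →ₗ[ℂ] QOp R) : Prop :=
  ∃ F₀ : QOp {x.1} →ₗ[ℂ] QOp {x.1},
    IsCPTP F₀ ∧ F = actOn (Finset.singleton_subset_iff.2 x.2) F₀

/-- There is a CPTP map `F` acting only on `x` with `‖tr_{¬y} (E F - E)‖₁ ≥ ε`. -/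
def Affects (ε : ℝ) (E : QOp R →ₗ[ℂ] QOp R) (x y : ↥R) : Prop :=
  ∃ F : QOp R →ₗ[ℂ] QOp R, IsCPTPOnlyOn x F ∧
    ε ≤ opTraceNorm ((partialTrace {y.1} R) ∘ₗ (E ∘ₗ F - E))

/-- `ε`-input sensitivity, with at least `N` sensitive input qubits `x`. -/
def IsInputSensitive (ε N : ℝ) (E : QOp R →ₗ[ℂ] QOp R) : Prop :=
  ∃ y : ↥R, ∃ S : Finset ↥R, N ≤ (S.card : ℝ) ∧ ∀ x ∈ S, Affects ε E x y

/-- `ε`-output sensitivity, with at least `N` sensitive output qubits `y`. -/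
def IsOutputSensitive (ε N : ℝ) (E : QOp R →ₗ[ℂ] QOp R) : Prop :=
  ∃ x : ↥R, ∃ S : Finset ↥R, N ≤ (S.card : ℝ) ∧ ∀ y ∈ S, Affects ε E x y

/-- A family `E n` of operations on the finite sets `Q n` of qubits is `ε`-sensitive if every `E n`
is `ε`-input or `ε`-output sensitive, where the number of sensitive qubits is `Ω(n)`. -/
def IsSensitiveFamily (ε : ℝ) {Q : ℕ → Finset V} (E : ∀ n, QOp (Q n) →ₗ[ℂ] QOp (Q n)) : Prop :=
  ∃ c : ℝ, 0 < c ∧ ∀ᶠ n : ℕ in atTop,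
    IsInputSensitive ε (c * n) (E n) ∨ IsOutputSensitive ε (c * n) (E n)

end Subsystems

/-! ### Non-adaptive nearest-neighbour circuits on the `k`-dimensional grid -/

/-- Two points of the grid `ℤ^k` are neighbours if their `ℓ₁` distance is one. -/
def Neighbors {k : ℕ} (p q : Fin k → ℤ) : Prop :=
  ∑ i, |p i - q i| = 1

/-- A basic operation on a finite region `R` of the grid: a quantum operation that is applied to a
single qubit or to two neighbouring qubits. -/
structure BasicOp {k : ℕ} (R : Finset (Fin k → ℤ)) where
  /-- the qubits acted on -/
  support : Finset (Fin k → ℤ)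
  support_subset : support ⊆ R
  isLocal : (∃ p, support = {p}) ∨ ∃ p q, Neighbors p q ∧ support = {p, q}
  /-- the quantum operation applied to them -/
  op : QOp support →ₗ[ℂ] QOp support
  isCPTP : IsCPTP op

/-- One timestep: a finite set of disjoint basic operations. -/
structure Step {k : ℕ} (R : Finset (Fin k → ℤ)) where
  ops : List (BasicOp R)
  disjoint : ops.Pairwise fun g h => Disjoint g.support h.support

/-- The operation performed in one timestep. The basic operations in it commute, as they act on
disjoint sets of qubits, so the order of the composition does not matter. -/
def Step.toMap {k : ℕ} {R : Finset (Fin k → ℤ)} (s : Step R) : QOp R →ₗ[ℂ] QOp R :=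
  s.ops.foldl (fun Φ g => actOn g.support_subset g.op ∘ₗ Φ) LinearMap.id

/-- A `k`-dimensional NANTC circuit whose data qubits are located at the points of `Q`. It uses a
finite region of the grid that contains `Q`; the other qubits of the region are ancillas. -/
structure Circuit {k : ℕ} (Q : Finset (Fin k → ℤ)) where
  region : Finset (Fin k → ℤ)
  data_subset : Q ⊆ region
  /-- the sets of operations `S₁, …, S_d`, in the order in which they are applied -/
  steps : List (Step region)

namespace Circuit

variable {k : ℕ} {Q : Finset (Fin k → ℤ)}

/-- The depth of a circuit: the number of timesteps. -/
def depth (C : Circuit Q) : ℕ := C.steps.length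

/-- The operation that a circuit performs on its data qubits: initialise all ancillas to `|0⟩`,
apply the timesteps in order, and discard the ancillas. -/
def toMap (C : Circuit Q) : QOp Q →ₗ[ℂ] QOp Q :=
  partialTrace Q C.region ∘ₗ
    C.steps.foldl (fun Φ s => s.toMap ∘ₗ Φ) LinearMap.id ∘ₗ
      addAncillas C.data_subset

end Circuit

end NANTC

end

/-! The proof is a light-cone argument. Neighbouring qubits differ by at most one in every
coordinate, so a timestep moves influence by at most one in the sup distance. Hence in a circuit of
depth `d` the output at `y` depends only on inputs in the cube of radius `d` about `y`. This is
proved by tracking an operator whose marginal on a cube vanishes: each timestep costs one unit of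
radius (`Step.partialTrace_box_eq_zero`).

If `x` lies outside that cube, acting on `x` does not change the circuit's output at `y`, so by the
triangle inequality it changes that of `E` by at most twice the approximation error, which is less
than `ε` (`opTraceNorm_comp_sub_le`). Thus `x` can affect `y` only within distance `d`
(`Circuit.abs_sub_le_depth_of_affects`). Both kinds of sensitivity then place `c₀ n` qubits in a
cube of `(2d+1)^k` grid points. -/

namespace NANTC

/-! ### Trace norm inequalities for Hermitian operators -/

section TraceNorm

open scoped ComplexOrder MatrixOrder

variable {m : Type*} [Fintype m] [DecidableEq m]

lemma re_trace_mul_nonneg {A P : Matrix m m ℂ} (hA : A.PosSemidef) (hP : P.PosSemidef) :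
    0 ≤ (A * P).trace.re := by
  obtain ⟨B, rfl⟩ := CStarAlgebra.nonneg_iff_eq_star_mul_self.mp hP.nonneg
  rw [← mul_assoc, Matrix.trace_mul_comm, ← mul_assoc]
  exact (Complex.nonneg_iff.mp (hA.mul_mul_conjTranspose_same B).trace_nonneg).1

lemma traceNorm_nonneg (A : Matrix m m ℂ) : 0 ≤ traceNorm A := by
  have h := (Matrix.nonneg_iff_posSemidef.mp (CFC.abs_nonneg A)).trace_nonneg
  have := (Complex.nonneg_iff.mp h).1
  unfold traceNorm
  positivity

/-- The trace norm of a difference of positive operators is at most half the sum of the traces. -/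
lemma traceNorm_sub_le_of_posSemidef {P N : Matrix m m ℂ} (hP : P.PosSemidef)
    (hN : N.PosSemidef) : traceNorm (P - N) ≤ (1 / 2) * (P.trace.re + N.trace.re) := by
  have hX : IsSelfAdjoint (P - N) := hP.isHermitian.sub hN.isHermitian
  set X := P - N with hXdef
  -- The spectrum is finite, so even the discontinuous sign function is admissible in the functional
  -- calculus.
  have hcont : ∀ f : ℝ → ℝ, ContinuousOn f (spectrum ℝ X) := fun f =>
    (Matrix.finite_real_spectrum (A := X)).continuousOn f
  let s : ℝ → ℝ := fun x => if 0 ≤ x then 1 else -1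
  set S := cfc s X with hS
  have habs : CFC.abs X = S * X := by
    conv_rhs => enter [2]; rw [← cfc_id ℝ X]
    rw [hS]
    rw [CFC.abs_eq_cfc_norm X hX, ← cfc_mul s id X (hcont _) (hcont _)]
    refine cfc_congr fun x _ => ?_
    simp only [s, Real.norm_eq_abs, id]
    split_ifs with h
    · simp [abs_of_nonneg h]
    · simp [abs_of_neg (not_le.mp h)]
  have h1 : S ≤ 1 := cfc_le_one s X fun x _ => by
    simp only [s]; split_ifs <;> norm_num
  have h2 : algebraMap ℝ (Matrix m m ℂ) (-1) ≤ S :=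
    algebraMap_le_cfc s (-1) X (fun x _ => by simp only [s]; split_ifs <;> norm_num) (hcont _) hX
  -- Since `-1 ≤ S ≤ 1`, `tr |X| = tr (S P) - tr (S N) ≤ tr P + tr N`.
  have e1 := re_trace_mul_nonneg (Matrix.le_iff.mp h1) hP
  have e2 := re_trace_mul_nonneg (Matrix.le_iff.mp h2) hN
  simp only [map_neg, map_one, sub_neg_eq_add, sub_mul, add_mul, one_mul, Matrix.trace_sub,
    Matrix.trace_add, Complex.sub_re, Complex.add_re] at e1 e2
  unfold traceNorm
  rw [habs, hXdef, mul_sub, Matrix.trace_sub, Complex.sub_re]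
  linarith

/-- The Jordan decomposition of a Hermitian operator. -/
lemma exists_posSemidef_sub_eq {A : Matrix m m ℂ} (hA : A.IsHermitian) :
    ∃ P N : Matrix m m ℂ, P.PosSemidef ∧ N.PosSemidef ∧ A = P - N ∧
      traceNorm A = (1 / 2) * (P.trace.re + N.trace.re) := by
  have hA' : IsSelfAdjoint A := hA
  refine ⟨A⁺, A⁻, Matrix.nonneg_iff_posSemidef.mp (CFC.posPart_nonneg A),
    Matrix.nonneg_iff_posSemidef.mp (CFC.negPart_nonneg A),
    (CFC.posPart_sub_negPart A hA').symm, ?_⟩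
  unfold traceNorm
  rw [← CFC.posPart_add_negPart A hA', Matrix.trace_add, Complex.add_re]

lemma traceNorm_sub_le {A B : Matrix m m ℂ} (hA : A.IsHermitian) (hB : B.IsHermitian) :
    traceNorm (A - B) ≤ traceNorm A + traceNorm B := by
  obtain ⟨P, N, hP, hN, rfl, hA'⟩ := exists_posSemidef_sub_eq hA
  obtain ⟨P', N', hP', hN', rfl, hB'⟩ := exists_posSemidef_sub_eq hB
  have h := traceNorm_sub_le_of_posSemidef (hP.add hN') (hN.add hP')
  rw [hA', hB', show P - N - (P' - N') = P + N' - (N + P') by abel]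
  simp only [Matrix.trace_add, Complex.add_re] at h
  linarith

/-- Positive trace preserving maps do not increase the trace norm of Hermitian operators. -/
lemma traceNorm_map_le {n : Type*} [Fintype n] [DecidableEq n]
    {Φ : Matrix m m ℂ →ₗ[ℂ] Matrix n n ℂ}
    (hpos : ∀ M : Matrix m m ℂ, M.PosSemidef → (Φ M).PosSemidef)
    (htr : ∀ M : Matrix m m ℂ, (Φ M).trace = M.trace)
    {A : Matrix m m ℂ} (hA : A.IsHermitian) : traceNorm (Φ A) ≤ traceNorm A := by
  obtain ⟨P, N, hP, hN, rfl, hA'⟩ := exists_posSemidef_sub_eq hA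
  rw [hA', map_sub, ← htr P, ← htr N]
  exact traceNorm_sub_le_of_posSemidef (hpos P hP) (hpos N hN)

lemma traceNorm_sub_le_one {A B : Matrix m m ℂ} (hA : IsDensity A) (hB : IsDensity B) :
    traceNorm (A - B) ≤ 1 := by
  have h := traceNorm_sub_le_of_posSemidef hA.1 hB.1
  rw [hA.2, hB.2] at h
  norm_num at h
  exact h

end TraceNorm

section Positivity

open scoped ComplexOrder

variable {m n : Type*} [Fintype m] [Fintype n] {Φ : Matrix m m ℂ →ₗ[ℂ] Matrix n n ℂ}

lemma IsCPTP.posSemidef (hΦ : IsCPTP Φ) {M : Matrix m m ℂ} (hM : M.PosSemidef) :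
    (Φ M).PosSemidef :=
  -- Positivity is complete positivity with a one-dimensional environment.
  (hΦ.completelyPositive 1 _ (hM.submatrix Prod.fst)).submatrix fun i => (i, 0)

lemma isDensity_map (hpos : ∀ M : Matrix m m ℂ, M.PosSemidef → (Φ M).PosSemidef)
    (htr : ∀ M : Matrix m m ℂ, (Φ M).trace = M.trace) {ρ : Matrix m m ℂ} (hρ : IsDensity ρ) :
    IsDensity (Φ ρ) :=
  ⟨hpos ρ hρ.1, (htr ρ).trans hρ.2⟩

end Positivity

/-! ### Distance between channels -/

section OpTraceNorm

open scoped ComplexOrder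

variable {m n : Type*} [Fintype m] [Fintype n] [DecidableEq n]

lemma opTraceNorm_nonneg (Φ : Matrix m m ℂ →ₗ[ℂ] Matrix n n ℂ) : 0 ≤ opTraceNorm Φ :=
  Real.iSup_nonneg fun _ => traceNorm_nonneg _

lemma traceNorm_le_opTraceNorm
    {Φ Ψ : Matrix m m ℂ →ₗ[ℂ] Matrix n n ℂ}
    (hΦ : ∀ ρ, IsDensity ρ → IsDensity (Φ ρ)) (hΨ : ∀ ρ, IsDensity ρ → IsDensity (Ψ ρ))
    {ρ : Matrix m m ℂ} (hρ : IsDensity ρ) :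
    traceNorm ((Φ - Ψ) ρ) ≤ opTraceNorm (Φ - Ψ) := by
  -- A real supremum bounds its terms only if the family is bounded above; the bound is 1, because
  -- both maps preserve density matrices.
  refine le_ciSup (f := fun ρ : {ρ : Matrix m m ℂ // IsDensity ρ} => traceNorm ((Φ - Ψ) ρ.1))
    ⟨1, ?_⟩ ⟨ρ, hρ⟩
  rintro _ ⟨σ, rfl⟩
  exact traceNorm_sub_le_one (hΦ _ σ.2) (hΨ _ σ.2)

/-- If the output `D` of `E'` does not depend on whether `F` is applied to the input, then that of
`E` depends on it by at most twice the distance of `E` and `E'`. -/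
lemma opTraceNorm_comp_sub_le {l : Type*} [Fintype l] [DecidableEq l]
    {E E' : Matrix m m ℂ →ₗ[ℂ] Matrix n n ℂ} {F : Matrix m m ℂ →ₗ[ℂ] Matrix m m ℂ}
    {D : Matrix n n ℂ →ₗ[ℂ] Matrix l l ℂ}
    (hE : ∀ ρ, IsDensity ρ → IsDensity (E ρ)) (hE' : ∀ ρ, IsDensity ρ → IsDensity (E' ρ))
    (hF : ∀ ρ, IsDensity ρ → IsDensity (F ρ))
    (hDpos : ∀ M : Matrix n n ℂ, M.PosSemidef → (D M).PosSemidef)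
    (hDtr : ∀ M : Matrix n n ℂ, (D M).trace = M.trace)
    (h : ∀ ρ, D (E' (F ρ)) = D (E' ρ)) :
    opTraceNorm (D ∘ₗ (E ∘ₗ F - E)) ≤ 2 * opTraceNorm (E - E') := by
  refine Real.iSup_le (fun ρ => ?_) (by have := opTraceNorm_nonneg (E - E'); positivity)
  -- The two inserted `E'` terms cancel by `h`.
  have hsub : (D ∘ₗ (E ∘ₗ F - E)) ρ.1 = D ((E - E') (F ρ.1)) - D ((E - E') ρ.1) := by
    simp only [LinearMap.comp_apply, LinearMap.sub_apply, map_sub, h]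
    abel
  have herm : ∀ σ, IsDensity σ → ((E - E') σ).IsHermitian := fun σ hσ =>
    (hE σ hσ).1.isHermitian.sub (hE' σ hσ).1.isHermitian
  have hermD : ∀ σ, IsDensity σ → (D ((E - E') σ)).IsHermitian := fun σ hσ => by
    rw [LinearMap.sub_apply, map_sub]
    exact (hDpos _ (hE σ hσ).1).isHermitian.sub (hDpos _ (hE' σ hσ).1).isHermitian
  have hle : ∀ σ, IsDensity σ → traceNorm (D ((E - E') σ)) ≤ opTraceNorm (E - E') := fun σ hσ =>
    (traceNorm_map_le hDpos hDtr (herm σ hσ)).trans (traceNorm_le_opTraceNorm hE hE' hσ)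
  rw [hsub]
  have h1 := traceNorm_sub_le (hermD _ (hF _ ρ.2)) (hermD _ ρ.2)
  have h2 := hle _ (hF _ ρ.2)
  have h3 := hle _ ρ.2
  linarith

end OpTraceNorm

end NANTC

namespace NANTC

/-! ### Partial traces, local operations and ancillas -/

section Subsystems

open scoped ComplexOrder

variable {V : Type*} [DecidableEq V] {A B K R S : Finset V}

lemma bits_merge_left (h : A ⊆ R) (a : ↥A → Fin 2) (b : ↥(R \ A) → Fin 2) :
    bits h (merge a b) = a := by
  funext v
  exact dif_pos v.2

lemma bits_merge_right (a : ↥A → Fin 2) (b : ↥(R \ A) → Fin 2) :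
    bits Finset.sdiff_subset (merge a b) = b := by
  funext v
  exact dif_neg (Finset.mem_sdiff.1 v.2).2

lemma merge_bits (h : A ⊆ R) (f : ↥R → Fin 2) :
    merge (bits h f) (bits Finset.sdiff_subset f) = f := by
  funext v
  unfold merge bits
  split_ifs <;> rfl

/-- A bit string on `R` is a pair of bit strings on `A` and on `R \ A`. -/
def splitEquiv (h : A ⊆ R) :
    (↥R → Fin 2) ≃ (↥A → Fin 2) × (↥(R \ A) → Fin 2) where
  toFun f := (bits h f, bits Finset.sdiff_subset f)
  invFun p := merge p.1 p.2
  left_inv f := merge_bits h f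
  right_inv _ := Prod.ext (bits_merge_left h _ _) (bits_merge_right _ _)

lemma sum_eq_sum_merge {β : Type*} [AddCommMonoid β] (h : A ⊆ R) (φ : (↥R → Fin 2) → β) :
    ∑ f, φ f = ∑ b : ↥(R \ A) → Fin 2, ∑ a : ↥A → Fin 2, φ (merge a b) := by
  rw [← (splitEquiv h).symm.sum_comp, Fintype.sum_prod_type, Finset.sum_comm]
  rfl

/-! ### The partial trace -/

lemma trace_partialTrace (h : A ⊆ R) (M : QOp R) : (partialTrace A R M).trace = M.trace := by
  simp only [Matrix.trace, Matrix.diag_apply]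
  rw [sum_eq_sum_merge h, Finset.sum_comm]
  rfl

lemma posSemidef_partialTrace {M : QOp R} (hM : M.PosSemidef) :
    (partialTrace A R M).PosSemidef := by
  have : partialTrace A R M =
      ∑ c : ↥(R \ A) → Fin 2, M.submatrix (fun a => merge a c) fun a => merge a c := by
    ext a b
    simp [partialTrace, Matrix.sum_apply]
  rw [this]
  exact Matrix.posSemidef_sum _ fun c _ => hM.submatrix _

/-- Tracing out in two stages. -/
lemma partialTrace_partialTrace (hAB : A ⊆ B) (hBR : B ⊆ R) (M : QOp R) :
    partialTrace A B (partialTrace B R M) = partialTrace A R M := by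
  have hsub : B \ A ⊆ R \ A := Finset.sdiff_subset_sdiff hBR le_rfl
  have hset : (R \ A) \ (B \ A) = R \ B := by
    ext v
    simp only [Finset.mem_sdiff]
    have := @hAB v
    tauto
  ext a b
  simp only [partialTrace, LinearMap.coe_mk, AddHom.coe_mk, Matrix.of_apply]
  rw [sum_eq_sum_merge hsub (fun c => M (merge a c) (merge b c)), Finset.sum_comm]
  have hcast : ∀ v, v ∈ (R \ A) \ (B \ A) ↔ v ∈ R \ B := fun v => by rw [hset]
  -- The two index sets are equal but give different types, so bit strings are transported.
  let e : (↥(R \ B) → Fin 2) ≃ (↥((R \ A) \ (B \ A)) → Fin 2) :=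
    Equiv.arrowCongr (Equiv.subtypeEquivRight fun v => (hcast v).symm) (Equiv.refl _)
  refine Fintype.sum_equiv e _ _ fun d => Finset.sum_congr rfl fun c _ => ?_
  have key : ∀ a : ↥A → Fin 2,
      (merge (merge a c : ↥B → Fin 2) d : ↥R → Fin 2) = merge a (merge c (e d)) := by
    intro a
    funext v
    have := @hAB v.1
    simp only [merge, e, Equiv.arrowCongr_apply, Function.comp_apply, Finset.mem_sdiff]
    split_ifs <;> first | rfl | (exfalso; tauto)
  rw [key, key]

/-! ### Local operations -/

lemma trace_actOn (h : S ⊆ R) {Φ : QOp S →ₗ[ℂ] QOp S} (hΦ : ∀ M, (Φ M).trace = M.trace)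
    (M : QOp R) : (actOn h Φ M).trace = M.trace := by
  simp only [Matrix.trace, Matrix.diag_apply]
  rw [sum_eq_sum_merge h, sum_eq_sum_merge h]
  refine Finset.sum_congr rfl fun c _ => ?_
  simp only [actOn, LinearMap.coe_mk, AddHom.coe_mk, Matrix.of_apply, bits_merge_left,
    bits_merge_right]
  exact hΦ (Matrix.of fun a b => M (merge a c) (merge b c))

/-- Full complete positivity is needed here: the environment is the span of all bit strings on `R \
S`, enumerated by `Fin`. -/
lemma posSemidef_actOn (h : S ⊆ R) {Φ : QOp S →ₗ[ℂ] QOp S} (hΦ : IsCPTP Φ) {M : QOp R}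
    (hM : M.PosSemidef) : (actOn h Φ M).PosSemidef := by
  let e := Fintype.equivFin (↥(R \ S) → Fin 2)
  let φ : (↥S → Fin 2) × Fin (Fintype.card (↥(R \ S) → Fin 2)) → (↥R → Fin 2) :=
    fun p => merge p.1 (e.symm p.2)
  let ψ : (↥R → Fin 2) → (↥S → Fin 2) × Fin (Fintype.card (↥(R \ S) → Fin 2)) :=
    fun f => (bits h f, e (bits Finset.sdiff_subset f))
  have : actOn h Φ M = (ampliation Φ _ (M.submatrix φ φ)).submatrix ψ ψ := by
    ext f g
    simp [actOn, ampliation, φ, ψ]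
  rw [this]
  exact (hΦ.completelyPositive _ _ (hM.submatrix φ)).submatrix ψ

/-- Operations on a part of the system commute with discarding qubits outside of that part. -/
lemma partialTrace_actOn_of_subset (hS : S ⊆ K) (hK : K ⊆ R) (Φ : QOp S →ₗ[ℂ] QOp S)
    (M : QOp R) :
    partialTrace K R (actOn (hS.trans hK) Φ M) = actOn hS Φ (partialTrace K R M) := by
  have key : ∀ (p : ↥S → Fin 2) (a : ↥K → Fin 2) (c : ↥(R \ K) → Fin 2),
      (merge p (bits Finset.sdiff_subset (merge a c : ↥R → Fin 2)) : ↥R → Fin 2) =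
        merge (merge p (bits Finset.sdiff_subset a) : ↥K → Fin 2) c := by
    intro p a c
    funext v
    have := @hS v.1
    simp only [merge, bits]
    split_ifs <;> first | rfl | (exfalso; tauto)
  have key' : ∀ (a : ↥K → Fin 2) (c : ↥(R \ K) → Fin 2),
      bits (hS.trans hK) (merge a c : ↥R → Fin 2) = bits hS a := fun a c => by
    funext v
    exact dif_pos (hS v.2)
  ext a b
  simp only [partialTrace, actOn, LinearMap.coe_mk, AddHom.coe_mk, Matrix.of_apply, key, key']
  rw [← Matrix.sum_apply, ← map_sum]
  refine congrFun (congrFun (congrArg Φ ?_) _) _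
  ext p q
  simp [Matrix.sum_apply]

/-- Trace preserving operations on discarded qubits have no effect. -/
lemma partialTrace_actOn_of_disjoint (hS : S ⊆ R) (hSB : Disjoint S B)
    {Φ : QOp S →ₗ[ℂ] QOp S} (hΦ : ∀ M, (Φ M).trace = M.trace) (M : QOp R) :
    partialTrace B R (actOn hS Φ M) = partialTrace B R M := by
  have hSR : S ⊆ R \ B := fun v hv =>
    Finset.mem_sdiff.2 ⟨hS hv, Finset.disjoint_left.1 hSB hv⟩
  have hnS : ∀ {v}, v ∈ B → v ∉ S := fun hv hv' => Finset.disjoint_left.1 hSB hv' hv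
  ext a b
  simp only [partialTrace, LinearMap.coe_mk, AddHom.coe_mk, Matrix.of_apply]
  rw [sum_eq_sum_merge hSR, sum_eq_sum_merge hSR]
  refine Finset.sum_congr rfl fun c _ => ?_
  have key' : ∀ (a : ↥B → Fin 2) (s : ↥S → Fin 2),
      bits hS (merge a (merge s c) : ↥R → Fin 2) = s := fun a s => by
    funext v
    have hv : v.1 ∉ B := Finset.disjoint_left.1 hSB v.2
    exact (dif_neg hv).trans (dif_pos v.2)
  have key : ∀ (p : ↥S → Fin 2) (a : ↥B → Fin 2) (s : ↥S → Fin 2),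
      (merge p (bits Finset.sdiff_subset (merge a (merge s c) : ↥R → Fin 2)) : ↥R → Fin 2) =
        merge a (merge p c) := by
    intro p a s
    funext v
    have := @hnS v.1
    simp only [merge, bits]
    split_ifs <;> first | rfl | (exfalso; tauto)
  simp only [actOn, LinearMap.coe_mk, AddHom.coe_mk, Matrix.of_apply, key, key']
  exact hΦ (Matrix.of fun p q => M (merge a (merge p c)) (merge b (merge q c)))

/-! ### Ancillas -/

lemma trace_addAncillas (h : A ⊆ R) (M : QOp A) : (addAncillas h M).trace = M.trace := by
  simp only [Matrix.trace, Matrix.diag_apply]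
  rw [sum_eq_sum_merge h]
  simp only [addAncillas, LinearMap.coe_mk, AddHom.coe_mk, Matrix.of_apply, bits_merge_left,
    bits_merge_right, and_self]
  rw [Finset.sum_eq_single 0]
  · simp
  · intro c _ hc
    simp [hc]
  · simp

lemma posSemidef_addAncillas (h : A ⊆ R) {M : QOp A} (hM : M.PosSemidef) :
    (addAncillas h M).PosSemidef := by
  -- `Z` projects onto ancillas in state 0; conjugating by it cuts `M` tensored with the all-ones
  -- matrix down to the prepared state.
  let Z : Matrix (↥R → Fin 2) (↥R → Fin 2) ℂ :=
    Matrix.diagonal fun f => if bits (A := R \ A) Finset.sdiff_subset f = 0 then 1 else 0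
  have : addAncillas h M = Z * M.submatrix (bits h) (bits h) * Z.conjTranspose := by
    ext f g
    simp only [Z, Matrix.diagonal_conjTranspose, Matrix.mul_diagonal, Matrix.diagonal_mul,
      addAncillas, LinearMap.coe_mk, AddHom.coe_mk, Matrix.of_apply, Matrix.submatrix_apply,
      Pi.star_apply]
    split_ifs <;> simp_all
  rw [this]
  exact (hM.submatrix _).mul_mul_conjTranspose_same Z

/-- Operations on data qubits commute with the preparation of ancillas. -/
lemma addAncillas_actOn (hS : S ⊆ A) (hA : A ⊆ R) (Φ : QOp S →ₗ[ℂ] QOp S) (M : QOp A) :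
    addAncillas hA (actOn hS Φ M) = actOn (hS.trans hA) Φ (addAncillas hA M) := by
  have h1 : ∀ (p : ↥S → Fin 2) (f : ↥R → Fin 2),
      bits (A := R \ A) Finset.sdiff_subset
        (merge p (bits Finset.sdiff_subset f) : ↥R → Fin 2) = bits Finset.sdiff_subset f := by
    intro p f
    funext v
    exact dif_neg fun h => (Finset.mem_sdiff.1 v.2).2 (hS h)
  have h2 : ∀ (p : ↥S → Fin 2) (f : ↥R → Fin 2),
      bits hA (merge p (bits Finset.sdiff_subset f) : ↥R → Fin 2) =
        merge p (bits Finset.sdiff_subset (bits hA f)) := by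
    intro p f
    funext v
    rfl
  ext f g
  simp only [addAncillas, actOn, LinearMap.coe_mk, AddHom.coe_mk, Matrix.of_apply, h1, h2]
  split_ifs with h
  · rfl
  · exact (congrFun (congrFun (map_zero Φ) _) _).symm

end Subsystems

end NANTC

namespace NANTC

/-! ### Light cones -/

section LightCone

open scoped ComplexOrder

variable {k : ℕ} {R : Finset (Fin k → ℤ)}

lemma Neighbors.abs_sub_le_one {p q : Fin k → ℤ} (h : Neighbors p q) (i : Fin k) :
    |p i - q i| ≤ 1 :=
  (Finset.single_le_sum (f := fun i => |p i - q i|) (fun _ _ => abs_nonneg _)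
    (Finset.mem_univ i)).trans_eq h

lemma BasicOp.abs_sub_le_one (g : BasicOp R) {p q : Fin k → ℤ} (hp : p ∈ g.support)
    (hq : q ∈ g.support) (i : Fin k) : |p i - q i| ≤ 1 := by
  rcases g.isLocal with ⟨v, hv⟩ | ⟨v, w, hvw, hv⟩ <;> rw [hv] at hp hq
  · simp_all
  · have := hvw.abs_sub_le_one i
    have := abs_sub_comm (v i) (w i)
    simp only [Finset.mem_insert, Finset.mem_singleton] at hp hq
    rcases hp with rfl | rfl <;> rcases hq with rfl | rfl <;> simp <;> omega

/-- The points of `R` whose coordinates all differ by at most `j` from those of `y`. -/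
def box (R : Finset (Fin k → ℤ)) (y : Fin k → ℤ) (j : ℕ) : Finset (Fin k → ℤ) :=
  R.filter fun v => ∀ i, |v i - y i| ≤ j

lemma box_subset (y : Fin k → ℤ) (j : ℕ) : box R y j ⊆ R := Finset.filter_subset _ _

/-- Composing maps that satisfy `P`. -/
lemma foldl_comp_induction {α M : Type*} [AddCommMonoid M] [Module ℂ M] (f : α → M →ₗ[ℂ] M)
    (P : M → Prop) (l : List α) (hf : ∀ g ∈ l, ∀ D, P D → P (f g D)) (Φ : M →ₗ[ℂ] M) (D : M)
    (hD : P (Φ D)) : P (l.foldl (fun Φ g => f g ∘ₗ Φ) Φ D) := by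
  induction l generalizing Φ with
  | nil => exact hD
  | cons g l ih =>
    exact ih (fun g hg => hf g (List.mem_cons_of_mem _ hg)) (f g ∘ₗ Φ)
      (hf g List.mem_cons_self _ hD)

lemma Step.posSemidef_toMap (s : Step R) {M : QOp R} (hM : M.PosSemidef) :
    (s.toMap M).PosSemidef :=
  foldl_comp_induction (fun g : BasicOp R => actOn g.support_subset g.op) (fun D => D.PosSemidef)
    s.ops (fun g _ _ hD => posSemidef_actOn _ g.isCPTP hD) LinearMap.id M hM

lemma Step.trace_toMap (s : Step R) (M : QOp R) : (s.toMap M).trace = M.trace :=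
  foldl_comp_induction (fun g : BasicOp R => actOn g.support_subset g.op)
    (fun D => D.trace = M.trace) s.ops
    (fun g _ D hD => (trace_actOn _ g.isCPTP.tracePreserving D).trans hD) LinearMap.id M rfl

/-- If an operator vanishes on the box of radius `j + 1`, then after one timestep it vanishes on
the box of radius `j`. -/
lemma Step.partialTrace_box_eq_zero (s : Step R) (y : Fin k → ℤ) (j : ℕ) {D : QOp R}
    (hD : partialTrace (box R y (j + 1)) R D = 0) :
    partialTrace (box R y j) R (s.toMap D) = 0 := by
  set B := box R y j with hB
  -- `K` is `B` together with every operation touching it. As operations in a timestep are disjoint,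
  -- each lies inside `K` or avoids it, so it either commutes with tracing down to `K` or
  -- disappears.
  let K := R.filter fun v => v ∈ B ∨ ∃ g ∈ s.ops, ¬ Disjoint g.support B ∧ v ∈ g.support
  have hKR : K ⊆ R := Finset.filter_subset _ _
  have hBK : B ⊆ K := fun v hv => Finset.mem_filter.2 ⟨box_subset y j hv, Or.inl hv⟩
  have hKbox : K ⊆ box R y (j + 1) := by
    intro v hv
    obtain ⟨hvR, hv⟩ := Finset.mem_filter.1 hv
    refine Finset.mem_filter.2 ⟨hvR, fun i => ?_⟩
    rcases hv with hv | ⟨g, -, hg, hvg⟩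
    · have := (Finset.mem_filter.1 hv).2 i
      push_cast
      omega
    · obtain ⟨w, hwg, hwB⟩ := Finset.not_disjoint_iff.1 hg
      have h1 := (Finset.mem_filter.1 hwB).2 i
      have h2 := g.abs_sub_le_one hvg hwg i
      have h3 := abs_sub_le (v i) (w i) (y i)
      push_cast
      omega
  have hcases : ∀ g ∈ s.ops, g.support ⊆ K ∨ Disjoint g.support K := by
    intro g hg
    by_cases hgB : Disjoint g.support B
    · refine Or.inr (Finset.disjoint_left.2 fun v hvg hvK => ?_)
      rcases (Finset.mem_filter.1 hvK).2 with hv | ⟨g', hg', hgB', hvg'⟩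
      · exact Finset.disjoint_left.1 hgB hvg hv
      · have hne : g ≠ g' := by
          rintro rfl
          exact hgB' hgB
        have : Std.Symm fun g h : BasicOp R => Disjoint g.support h.support :=
          ⟨fun _ _ h => h.symm⟩
        have := s.disjoint.forall hg hg' hne
        exact Finset.disjoint_left.1 this hvg hvg'
    · exact Or.inl fun v hv =>
        Finset.mem_filter.2 ⟨g.support_subset hv, Or.inr ⟨g, hg, hgB, hv⟩⟩
  have hDK : partialTrace K R D = 0 := by
    rw [← partialTrace_partialTrace hKbox (box_subset y _), hD, map_zero]
  have hK : partialTrace K R (s.toMap D) = 0 := by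
    refine foldl_comp_induction (fun g : BasicOp R => actOn g.support_subset g.op)
      (fun D => partialTrace K R D = 0) s.ops (fun g hg D hD => ?_) LinearMap.id D hDK
    rcases hcases g hg with h | h
    · rw [partialTrace_actOn_of_subset h hKR, hD, map_zero]
    · rw [partialTrace_actOn_of_disjoint _ h g.isCPTP.tracePreserving, hD]
  rw [← partialTrace_partialTrace hBK hKR, hK, map_zero]

/-- The radius is the number of timesteps still to come; `Φ` is general because the fold accumulates
the earlier ones. -/
lemma partialTrace_foldl_box_eq_zero (l : List (Step R)) (y : Fin k → ℤ) (Φ : QOp R →ₗ[ℂ] QOp R)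
    {D : QOp R} (hD : partialTrace (box R y l.length) R (Φ D) = 0) :
    partialTrace (box R y 0) R (l.foldl (fun Φ s => s.toMap ∘ₗ Φ) Φ D) = 0 := by
  induction l generalizing Φ with
  | nil => exact hD
  | cons s l ih => exact ih (s.toMap ∘ₗ Φ) (s.partialTrace_box_eq_zero y _ hD)

end LightCone

/-! ### Locality of whole circuits -/

namespace Circuit

open scoped ComplexOrder

variable {k : ℕ} {Q : Finset (Fin k → ℤ)}

lemma posSemidef_toMap (C : Circuit Q) {M : QOp Q} (hM : M.PosSemidef) :
    (C.toMap M).PosSemidef := by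
  have h := posSemidef_addAncillas C.data_subset hM
  have h' := foldl_comp_induction Step.toMap (fun D : QOp C.region => D.PosSemidef) C.steps
    (fun s _ _ hD => s.posSemidef_toMap hD) LinearMap.id _ h
  simp only [toMap, LinearMap.comp_apply]
  exact posSemidef_partialTrace h'

lemma trace_toMap (C : Circuit Q) (M : QOp Q) : (C.toMap M).trace = M.trace :=
  (trace_partialTrace C.data_subset _).trans <|
    foldl_comp_induction Step.toMap (fun D => D.trace = M.trace) C.steps
      (fun s _ D hD => (s.trace_toMap D).trans hD) LinearMap.id _ (trace_addAncillas _ M)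

/-- An operation on a qubit `x` outside of the light cone of `y` does not influence `y`. -/
lemma partialTrace_toMap_eq (C : Circuit Q) {x y : ↥Q} {F : QOp Q →ₗ[ℂ] QOp Q}
    (hF : IsCPTPOnlyOn x F) {i : Fin k} (hxy : (C.depth : ℤ) < |x.1 i - y.1 i|) (ρ : QOp Q) :
    partialTrace {y.1} Q (C.toMap (F ρ)) = partialTrace {y.1} Q (C.toMap ρ) := by
  obtain ⟨F₀, hF₀, rfl⟩ := hF
  set R := C.region
  have hQR : Q ⊆ R := C.data_subset
  have hyQ : {y.1} ⊆ Q := Finset.singleton_subset_iff.2 y.2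
  have hxQ : {x.1} ⊆ Q := Finset.singleton_subset_iff.2 x.2
  have hybox : {y.1} ⊆ box R y.1 0 := Finset.singleton_subset_iff.2 <|
    Finset.mem_filter.2 ⟨hQR y.2, fun i => by simp⟩
  have hdisj : Disjoint {x.1} (box R y.1 C.depth) := by
    rw [Finset.disjoint_singleton_left]
    exact fun h => absurd ((Finset.mem_filter.1 h).2 i) (not_le.2 hxy)
  -- By linearity the circuit is applied to `F ρ - ρ`, whose marginal on the cube vanishes once
  -- ancillas are added.
  rw [← sub_eq_zero, ← map_sub, ← map_sub]
  simp only [toMap, LinearMap.comp_apply]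
  rw [partialTrace_partialTrace hyQ hQR,
    ← partialTrace_partialTrace hybox (box_subset y.1 0),
    partialTrace_foldl_box_eq_zero, map_zero]
  rw [LinearMap.id_apply, map_sub, map_sub, addAncillas_actOn hxQ hQR]
  exact sub_eq_zero.2 (partialTrace_actOn_of_disjoint _ hdisj hF₀.tracePreserving _)

/-- A circuit that approximates `E` well has depth at least the distance of any two qubits of which
one affects the other under `E`. -/
lemma abs_sub_le_depth_of_affects (C : Circuit Q) {ε : ℝ} {E : QOp Q →ₗ[ℂ] QOp Q}
    (hE : IsCPTP E) (hC : opTraceNorm (E - C.toMap) < ε / 2) {x y : ↥Q} (h : Affects ε E x y)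
    (i : Fin k) : |x.1 i - y.1 i| ≤ C.depth := by
  by_contra hxy
  obtain ⟨F, hF, hε⟩ := h
  have hFdens : ∀ ρ, IsDensity ρ → IsDensity (F ρ) := by
    obtain ⟨F₀, hF₀, rfl⟩ := hF
    exact fun ρ => isDensity_map (fun _ => posSemidef_actOn _ hF₀)
      (trace_actOn _ hF₀.tracePreserving)
  have := opTraceNorm_comp_sub_le
    (fun ρ => isDensity_map (fun _ => hE.posSemidef) hE.tracePreserving)
    (fun ρ => isDensity_map (fun _ => C.posSemidef_toMap) C.trace_toMap) hFdens
    (fun _ => posSemidef_partialTrace)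
    (trace_partialTrace (Finset.singleton_subset_iff.2 y.2))
    (C.partialTrace_toMap_eq hF (not_le.1 hxy))
  linarith

end Circuit

/-- The number of grid points in a box. -/
lemma card_le_of_abs_sub_le {k d : ℕ} {Q : Finset (Fin k → ℤ)} (z : Fin k → ℤ) (S : Finset ↥Q)
    (h : ∀ x ∈ S, ∀ i, |x.1 i - z i| ≤ d) : S.card ≤ (2 * d + 1) ^ k := by
  have hsub : S.map (Function.Embedding.subtype _) ⊆
      Fintype.piFinset fun i => Finset.Icc (z i - d) (z i + d) := by
    intro v hv
    obtain ⟨x, hx, rfl⟩ := Finset.mem_map.1 hv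
    refine Fintype.mem_piFinset.2 fun i => Finset.mem_Icc.2 ?_
    have := abs_le.1 (h x hx i)
    simp only [Function.Embedding.subtype_apply]
    omega
  have hcard := Finset.card_le_card hsub
  rw [Finset.card_map, Fintype.card_piFinset] at hcard
  refine hcard.trans_eq ?_
  have : ∀ i, (Finset.Icc (z i - d) (z i + d)).card = 2 * d + 1 := fun i => by
    rw [Int.card_Icc]
    omega
  simp [this]

end NANTC

/-! ### From counting to the depth bound -/

theorem mainTheorem9 (k : ℕ) (hk : 1 ≤ k) (ε : ℝ)
    (Q : ℕ → Finset (Fin k → ℤ))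
    (E : ∀ n, NANTC.QOp (Q n) →ₗ[ℂ] NANTC.QOp (Q n))
    (hE : ∀ n, NANTC.IsCPTP (E n))
    (hsens : NANTC.IsSensitiveFamily ε E)
    (C : ∀ n, NANTC.Circuit (Q n))
    (hC : ∀ n, NANTC.opTraceNorm (E n - (C n).toMap) < ε / 2) :
    ∃ c : ℝ, 0 < c ∧ ∀ᶠ n : ℕ in atTop,
      c * (n : ℝ) ^ (1 / (k : ℝ)) ≤ ((C n).depth : ℝ) := by
  obtain ⟨c₀, hc₀, hev⟩ := hsens
  have hk0 : (k : ℝ) ≠ 0 := by positivity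
  have hcard : ∀ᶠ n : ℕ in atTop, c₀ * n ≤ ((2 * (C n).depth + 1 : ℕ) : ℝ) ^ k := by
    filter_upwards [hev] with n hn
    rcases hn with ⟨y, S, hS, hx⟩ | ⟨x, S, hS, hy⟩
    · refine hS.trans (mod_cast NANTC.card_le_of_abs_sub_le y.1 S fun x hxS => ?_)
      exact (C n).abs_sub_le_depth_of_affects (hE n) (hC n) (hx x hxS)
    · refine hS.trans (mod_cast NANTC.card_le_of_abs_sub_le x.1 S fun y hyS i => ?_)
      rw [abs_sub_comm]
      exact (C n).abs_sub_le_depth_of_affects (hE n) (hC n) (hy y hyS) i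
  have hlarge : ∀ᶠ n : ℕ in atTop, (2 : ℝ) ≤ (c₀ * n) ^ (1 / (k : ℝ)) :=
    ((tendsto_rpow_atTop (by positivity)).comp
      (tendsto_natCast_atTop_atTop.const_mul_atTop hc₀)).eventually_ge_atTop 2
  -- With `X = (c₀ n)^(1/k)`, counting gives `X ≤ 2d + 1`; once `X ≥ 2`, this yields `d ≥ (X - 1)/2
  -- ≥ X/4`.
  refine ⟨c₀ ^ (1 / (k : ℝ)) / 4, by positivity, ?_⟩
  filter_upwards [hcard, hlarge] with n h1 h2
  have h3 : (c₀ * n) ^ (1 / (k : ℝ)) ≤ 2 * ((C n).depth : ℝ) + 1 := by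
    refine (Real.rpow_le_rpow (by positivity) h1 (by positivity)).trans_eq ?_
    rw [one_div, Real.pow_rpow_inv_natCast (by positivity) (by omega)]
    push_cast
    ring
  have h4 := Real.mul_rpow (z := 1 / (k : ℝ)) hc₀.le (Nat.cast_nonneg (α := ℝ) n)
  rw [div_mul_eq_mul_div, ← h4]
  linarith
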